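/- A tracial $C^*$-probability space $(M,\tau)$ is a unital $C^*$-algebra $M$ with a trace state $\tau$ (a positive linear functional with $\tau(1)=1$ and $\tau(xy)=\tau(yx)$). Let $1\le p\le\infty$ and let $|x|_{p,\tau}$ be the norm of $x\in M$ in $L^p(M,\tau)$: $|x|_{p,\tau}=\tau\big((x^*x)^{p/2}\big)^{1/p}$ if $p<\infty$, and $|x|_{\infty,\tau}$ is the operator norm of left multiplication by $x$ on $L^2(M,\tau)$. Let $\|\cdot\|_p$ be the $p$-norm on $\mathbb R^n$. The $*$-distribution of an $n$-tuple $X=(X_1,\dots,X_n)$ in $(M,\tau)$ is the linear functional $P\mapsto\tau(P(X,X^*))$ on noncommutative $*$-polynomials in $n$ variables; convergence in $*$-distribution is pointwise convergence of these functionals. For $n$-tuples $X$ in $(M_1,\tau_1)$ and $Y$ in $(M_2,\tau_2)$, tracial $C^*$-probability spaces, let $$W_p(X,Y)=\inf\ \big\|\big(|X_j'-Y_j'|_{p,\tau_3}\big)_{1\le j\le n}\big\|_p ,$$ the infimum being over all $2n$-tuples $(X_1',\dots,X_n',Y_1',\dots,Y_n')$ in some tracial $C^*$-probability space $(M_3,\tau_3)$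 such that $X'$ has the same $*$-distribution as $X$ and $Y'$ has the same $*$-distribution as $Y$. For a unital $C^*$-algebra $A$ generated by a specified $n$-tuple $a=(a_1,\dots,a_n)$, let $TS(A)$ be the set of trace states of $A$, and for $\tau',\tau''\in TS(A)$ let $W_p(\tau',\tau'')=W_p(a',a'')$, where $a'$ and $a''$ denote the $n$-tuple $a$ regarded in $(A,\tau')$ and in $(A,\tau'')$ respectively. Let $\sigma_1,\sigma_2:A\to A*A$ be the canonical homomorphisms into the full free product $C^*$-algebra (amalgamated over $\mathbb C1$), and let $TS(A*A;\tau',\tau'')$ be the set of $\tau\in TS(A*A)$ with $\tau\circ\sigma_1=\tau'$ and $\tau\circ\sigma_2=\tau''$. **Proposition 1.4.** (a) The infimum in the definition of $W_p$ is attained, both for $n$-tuples and for trace states: for all $X,Y$ as above there are $(M_3,\tau_3)$ and $(X',Y')$ as above with $W_p(X,Y)=\|(|X'_j-Y'_j|_{p,\tau_3})_j\|_p$ (in particular for $W_p(\tau',\tau'')=W_p(a',a'')$); and, for all $\tau',\tau''\in TS(A)$, $$W_p(\tau',\tau'')=\min\big\{\big\|\big(|\sigma_1(a_j)-\sigma_2(a_j)|_{p,\tau}\big)_{1\le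 j\le n}\big\|_p \ :\ \tau\in TS(A*A;\tau',\tau'')\big\}.$$ (b) Let $\tau_1^{(k)},\tau_1,\tau_2^{(k)},\tau_2\in TS(A)$ be such that $\tau_j^{(k)}\to\tau_j$ in the weak* topology as $k\to\infty$ $(j=1,2)$. Then $$\liminf_{k\to\infty}W_p(\tau_1^{(k)},\tau_2^{(k)})\ \ge\ W_p(\tau_1,\tau_2).$$ (c) Let $X^{(k)}$, $X$, $Y^{(k)}$, $Y$ $(k\in\mathbb N)$ be $n$-tuples of variables in tracial $C^*$-probability spaces (which may all be different) with $\|X_j^{(k)}\|\le R$, $\|X_j\|\le R$, $\|Y_j^{(k)}\|\le R$, $\|Y_j\|\le R$ for all $j,k$ and some constant $R$. Assume that $X^{(k)}$ and $Y^{(k)}$ converge in $*$-distribution to $X$ and $Y$ respectively as $k\to\infty$. Then $$\liminf_{k\to\infty}W_p(X^{(k)},Y^{(k)})\ \ge\ W_p(X,Y).$$ -/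

import Mathlib

open scoped ENNReal ComplexOrder Topology

universe u v w

noncomputable section

namespace FreeWasserstein

/-- A trace state on a unital C*-algebra `M`: a positive linear functional `τ : M → ℂ` with
`τ 1 = 1` and `τ (x * y) = τ (y * x)`.  (Positive functionals are automatically bounded.)
A pair `(M, τ)` is a tracial C*-probability space. -/
structure TraceState (M : Type*) [CStarAlgebra M] where
  /-- the underlying functional -/
  toFun : M →ₗ[ℂ] ℂ
  map_one' : toFun 1 = 1
  nonneg' : ∀ x : M, 0 ≤ toFun (star x * x)
  tracial' : ∀ x y : M, toFun (x * y) = toFun (y * x)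

/-- The norm of `x` in `L^p(M, τ)`.  For `p < ∞` it is `τ(|x|^p)^(1/p)`, where
`|x|^p = (x* x)^(p/2)` is formed by continuous functional calculus.  For `p = ∞` it is the operator
norm of left multiplication by `x` on `L²(M, τ)`. -/
def TraceState.lpNorm {M : Type*} [CStarAlgebra M] (τ : TraceState M) (p : ℝ≥0∞) (x : M) : ℝ :=
  if p = ∞ then
    sInf {C : ℝ | 0 ≤ C ∧ ∀ b : M,
      (τ.toFun (star (x * b) * (x * b))).re ≤ C ^ 2 * (τ.toFun (star b * b)).re}
  else
    (τ.toFun (cfc (fun t : ℝ => t ^ (p.toReal / 2)) (star x * x))).re ^ (1 / p.toReal)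

/-- The evaluation of a noncommutative *-polynomial (the generator `Sum.inl j` stands for the
`j`-th variable, `Sum.inr j` for its adjoint) at an `n`-tuple. -/
def evalStar {M : Type*} [CStarAlgebra M] {n : ℕ} (X : Fin n → M) :
    FreeAlgebra ℂ (Fin n ⊕ Fin n) →ₐ[ℂ] M :=
  FreeAlgebra.lift ℂ (Sum.elim X (fun j => star (X j)))

/-- The *-distribution of the `n`-tuple `X` in `(M, τ)`. -/
def starDistribution {M : Type*} [CStarAlgebra M] {n : ℕ} (τ : TraceState M) (X : Fin n → M) :
    FreeAlgebra ℂ (Fin n ⊕ Fin n) →ₗ[ℂ] ℂ :=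
  τ.toFun ∘ₗ (evalStar X).toLinearMap

/-- The quantity `‖(|X_j - Y_j|_p)_j‖_p`, with the `p`-norm of `ℝⁿ` outside. -/
def transportCost {M : Type*} [CStarAlgebra M] {n : ℕ} (p : ℝ≥0∞) (τ : TraceState M)
    (X Y : Fin n → M) : ℝ :=
  ‖(WithLp.toLp p (fun j => τ.lpNorm p (X j - Y j)) : PiLp p (fun _ : Fin n => ℝ))‖

/-- The set of costs `‖(|X'_j - Y'_j|_p)_j‖_p` of all `2n`-tuples `(X', Y')` in some tracial
C*-probability space `(M₃, τ₃)` such that `X'` has the *-distribution of `X` and `Y'` has that of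
`Y`.  (The values depend on the joint *-distribution of `(X', Y')` only, and each such distribution
is realized in every universe, so the set is the same for every choice of `w`.) -/
def couplingCosts {M₁ : Type u} {M₂ : Type v} [CStarAlgebra M₁] [CStarAlgebra M₂] {n : ℕ}
    (p : ℝ≥0∞) (τ₁ : TraceState M₁) (X : Fin n → M₁) (τ₂ : TraceState M₂) (Y : Fin n → M₂) :
    Set ℝ :=
  {c | ∃ (M₃ : Type w) (_ : CStarAlgebra M₃) (τ₃ : TraceState M₃) (X' Y' : Fin n → M₃),
    starDistribution τ₃ X' = starDistribution τ₁ X ∧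
    starDistribution τ₃ Y' = starDistribution τ₂ Y ∧
    c = transportCost p τ₃ X' Y'}

/-- The free `p`-Wasserstein distance between `n`-tuples of noncommutative random variables. -/
def wasserstein {M₁ : Type u} {M₂ : Type v} [CStarAlgebra M₁] [CStarAlgebra M₂] {n : ℕ}
    (p : ℝ≥0∞) (τ₁ : TraceState M₁) (X : Fin n → M₁) (τ₂ : TraceState M₂) (Y : Fin n → M₂) : ℝ :=
  sInf (couplingCosts.{u, v, w} p τ₁ X τ₂ Y)

/-- `a` generates `A` as a unital C*-algebra. -/
def Generates {A : Type u} [CStarAlgebra A] {n : ℕ} (a : Fin n → A) : Prop :=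
  (StarAlgebra.adjoin ℂ (Set.range a)).topologicalClosure = ⊤

/-- The free `p`-Wasserstein distance between trace states of a C*-algebra with specified
generator `a`. -/
def traceWasserstein {A : Type u} [CStarAlgebra A] {n : ℕ} (p : ℝ≥0∞) (a : Fin n → A)
    (τ' τ'' : TraceState A) : ℝ :=
  wasserstein.{u, u, w} p τ' a τ'' a

/-! ### The full free product of two unital C*-algebras, amalgamated over the scalars

It is the completion of the algebraic free product for the largest C*-seminorm, realized
as the C*-algebra generated by the two canonical images in the `ℓ^∞`-product over all
pairs of unital *-homomorphisms into a common unital C*-algebra. -/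

section FreeProduct

variable (A₁ A₂ : Type u) [CStarAlgebra A₁] [CStarAlgebra A₂]

/-- A pair of unital *-homomorphisms of `A₁`, `A₂` into a common (nonzero) unital C*-algebra. -/
structure RepPair where
  /-- the target -/
  carrier : Type u
  [cstar : CStarAlgebra carrier]
  [nontriv : Nontrivial carrier]
  /-- the homomorphism on `A₁` -/
  fst : A₁ →⋆ₐ[ℂ] carrier
  /-- the homomorphism on `A₂` -/
  snd : A₂ →⋆ₐ[ℂ] carrier

attribute [instance] RepPair.cstar RepPair.nontriv

/-- The `ℓ^∞`-product of the targets of all pairs of unital *-homomorphisms. -/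
abbrev RepProd : Type (u + 1) := lp (fun i : RepPair A₁ A₂ => i.carrier) ∞

instance : CStarAlgebra (RepProd A₁ A₂) where

variable {A₁ A₂} in
/-- The *-homomorphism into the product with given coordinates. -/
def toRepProd {B : Type u} [CStarAlgebra B] (f : ∀ i : RepPair A₁ A₂, B →⋆ₐ[ℂ] i.carrier) :
    B →⋆ₐ[ℂ] RepProd A₁ A₂ where
  toFun b := ⟨fun i => f i b, memℓp_infty ⟨‖b‖, by
    rintro _ ⟨i, rfl⟩
    exact NonUnitalStarAlgHom.norm_apply_le (f i) b⟩⟩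
  map_one' := by ext i; simp
  map_mul' x y := by ext i; simp
  map_zero' := by ext i; simp
  map_add' x y := by ext i; exact map_add (f i) x y
  commutes' r := by
    ext i
    exact AlgHomClass.commutes (f i) r
  map_star' x := by ext i; simp [map_star]

/-- The full free product `A₁ * A₂` as a C*-subalgebra of the product. -/
def freeProductSubalgebra : StarSubalgebra ℂ (RepProd A₁ A₂) :=
  (StarAlgebra.adjoin ℂ
    (Set.range (toRepProd fun i : RepPair A₁ A₂ => i.fst) ∪
      Set.range (toRepProd fun i : RepPair A₁ A₂ => i.snd))).topologicalClosure

/-- The full free product C*-algebra `A₁ * A₂`. -/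
abbrev FreeProduct : Type (u + 1) := freeProductSubalgebra A₁ A₂

instance : IsClosed (freeProductSubalgebra A₁ A₂ : Set (RepProd A₁ A₂)) :=
  StarSubalgebra.isClosed_topologicalClosure _

/-- The canonical homomorphism `σ₁ : A₁ → A₁ * A₂`. -/
def incl₁ : A₁ →⋆ₐ[ℂ] FreeProduct A₁ A₂ :=
  StarAlgHom.codRestrict (toRepProd fun i : RepPair A₁ A₂ => i.fst) (freeProductSubalgebra A₁ A₂)
    fun x => StarSubalgebra.le_topologicalClosure _
      (StarAlgebra.subset_adjoin ℂ _ (Or.inl ⟨x, rfl⟩))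

/-- The canonical homomorphism `σ₂ : A₂ → A₁ * A₂`. -/
def incl₂ : A₂ →⋆ₐ[ℂ] FreeProduct A₁ A₂ :=
  StarAlgHom.codRestrict (toRepProd fun i : RepPair A₁ A₂ => i.snd) (freeProductSubalgebra A₁ A₂)
    fun x => StarSubalgebra.le_topologicalClosure _
      (StarAlgebra.subset_adjoin ℂ _ (Or.inr ⟨x, rfl⟩))

variable {A₁ A₂}

/-- `TS(A₁ * A₂; τ₁, τ₂)`: the trace states on the full free product which restrict to `τ₁` and
`τ₂`. -/
def jointTraceStates (τ₁ : TraceState A₁) (τ₂ : TraceState A₂) :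
    Set (TraceState (FreeProduct A₁ A₂)) :=
  {τ | (∀ x, τ.toFun (incl₁ A₁ A₂ x) = τ₁.toFun x) ∧ ∀ x, τ.toFun (incl₂ A₁ A₂ x) = τ₂.toFun x}

end FreeProduct

/-- The set of costs `‖(|σ₁(a_j) - σ₂(a_j)|_{p,τ})_j‖_p`, `τ ∈ TS(A * A; τ', τ'')`. -/
def freeProductCosts {A : Type u} [CStarAlgebra A] {n : ℕ} (p : ℝ≥0∞) (a : Fin n → A)
    (τ' τ'' : TraceState A) : Set ℝ :=
  {c | ∃ τ ∈ jointTraceStates τ' τ'',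
    c = transportCost p τ (fun j => incl₁ A A (a j)) (fun j => incl₂ A A (a j))}

end FreeWasserstein

end

/-! Everything rests on one compactness statement, `exists_limit_coupling`: for bounded tuples
converging in *-distribution along an ultrafilter, any choice of couplings has a limit coupling,
whose cost is at most every bound that holds eventually. Applied to a minimizing sequence of
couplings of fixed tuples it gives attainment; applied to optimal couplings it gives lower
semicontinuity. The limit coupling lives on an ℓ^∞-product with the ultralimit of the traces. For `p
< ∞` the costs converge; for `p = ∞` they may drop in the limit, which does no harm.

The ultraproduct needs operator norm bounds on the coupled tuples. Since traces need not be
faithful, the *-distribution does not bound the norms in the ambient algebra. After passing to the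
GNS image the operator norm is the `L^∞` norm, which by traciality is controlled by moments
(`TraceState.norm_mem_leftBounds_of_moments`). Thus `exists_normalized_coupling` yields a coupling
of no greater cost in which every *-polynomial in a coupled tuple has norm at most that of the
original; it also moves the coupling to any universe.

The same norm bounds extend `a j ↦ X' j` to a homomorphism of `A` (`Generates.exists_starAlgHom`),
so a coupling becomes a trace on the full free product. Couplings exist because the tensor product
of the two spaces is one. -/

noncomputable section

namespace FreeWasserstein

/-! ### Inequalities for traces and `L^p` norms -/

namespace TraceState

variable {M : Type*} [CStarAlgebra M] (τ : TraceState M)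

/-- A trace state as a positive linear map. -/
def toPositiveLinearMap [PartialOrder M] [StarOrderedRing M] : M →ₚ[ℂ] ℂ :=
  PositiveLinearMap.mk₀ τ.toFun fun x hx => by
    obtain ⟨y, rfl⟩ := CStarAlgebra.nonneg_iff_eq_star_mul_self.mp hx
    exact τ.nonneg' y

lemma toPositiveLinearMap_apply [PartialOrder M] [StarOrderedRing M] (x : M) :
    τ.toPositiveLinearMap x = τ.toFun x := rfl

lemma re_nonneg (x : M) : 0 ≤ (τ.toFun (star x * x)).re := (Complex.le_def.mp (τ.nonneg' x)).1

lemma nontrivial {M : Type*} [CStarAlgebra M] (τ : TraceState M) : Nontrivial M := by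
  refine ⟨⟨1, 0, fun h => ?_⟩⟩
  have := τ.map_one'
  rw [h, map_zero] at this
  exact zero_ne_one this

lemma norm_sq_le (x y : M) :
    ‖τ.toFun (star x * y)‖ ^ 2 ≤ (τ.toFun (star x * x)).re * (τ.toFun (star y * y)).re := by
  let _ := CStarAlgebra.spectralOrder M
  have := CStarAlgebra.spectralOrderedRing M
  let f := τ.toPositiveLinearMap
  have h : ‖τ.toFun (star x * y)‖ ≤ ‖f.toPreGNS x‖ * ‖f.toPreGNS y‖ :=
    norm_inner_le_norm (𝕜 := ℂ) (f.toPreGNS x) (f.toPreGNS y)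
  have hn : ∀ z, ‖f.toPreGNS z‖ ^ 2 = (τ.toFun (star z * z)).re := fun z => by
    rw [PositiveLinearMap.preGNS_norm_def]
    exact Real.sq_sqrt (τ.re_nonneg z)
  rw [← hn, ← hn, ← mul_pow]
  gcongr

lemma re_conj_le (x b : M) :
    (τ.toFun (star (x * b) * (x * b))).re ≤ ‖x‖ ^ 2 * (τ.toFun (star b * b)).re := by
  let _ := CStarAlgebra.spectralOrder M
  have := CStarAlgebra.spectralOrderedRing M
  have h : star (x * b) * (x * b) ≤ ‖x‖ ^ 2 • (star b * b) := by
    have := CStarAlgebra.star_left_conjugate_le_norm_smul (a := b) (b := star x * x)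
      (.star_mul_self x)
    rw [CStarRing.norm_star_mul_self, ← sq] at this
    simpa [mul_assoc] using this
  have h2 := OrderHomClass.mono τ.toPositiveLinearMap h
  rw [toPositiveLinearMap_apply, toPositiveLinearMap_apply, ← Complex.coe_smul, map_smul] at h2
  have h3 := (Complex.le_def.mp h2).1
  rwa [smul_eq_mul, Complex.re_ofReal_mul] at h3

lemma norm_apply_le (x : M) : ‖τ.toFun x‖ ≤ ‖x‖ := by
  have h1 := τ.norm_sq_le 1 x
  have h2 := τ.re_conj_le x 1
  simp only [star_one, one_mul, mul_one, τ.map_one', Complex.one_re] at h1 h2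
  exact (sq_le_sq₀ (norm_nonneg _) (norm_nonneg _)).mp (h1.trans h2)

lemma continuous_toFun : Continuous τ.toFun :=
  AddMonoidHomClass.continuous_of_bound τ.toFun 1 fun x => by simpa using τ.norm_apply_le x

/-- The pullback of a trace state along a unital *-homomorphism. -/
def comap {N : Type*} [CStarAlgebra N] (φ : N →⋆ₐ[ℂ] M) : TraceState N where
  toFun := τ.toFun ∘ₗ φ.toAlgHom.toLinearMap
  map_one' := by simpa using τ.map_one'
  nonneg' x := by simpa [map_star] using τ.nonneg' (φ x)
  tracial' x y := by simpa using τ.tracial' (φ x) (φ y)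

lemma comap_apply {N : Type*} [CStarAlgebra N] (φ : N →⋆ₐ[ℂ] M) (x : N) :
    (τ.comap φ).toFun x = τ.toFun (φ x) := rfl

/-- The bounds for left multiplication by `x` on `L²(M, τ)`. -/
def leftBounds (x : M) : Set ℝ :=
  {C : ℝ | 0 ≤ C ∧ ∀ b : M,
    (τ.toFun (star (x * b) * (x * b))).re ≤ C ^ 2 * (τ.toFun (star b * b)).re}

lemma norm_mem_leftBounds (x : M) : ‖x‖ ∈ τ.leftBounds x := ⟨norm_nonneg _, τ.re_conj_le x⟩

lemma lpNorm_top (x : M) : τ.lpNorm ∞ x = sInf (τ.leftBounds x) := by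
  simp [lpNorm, leftBounds]

lemma bddBelow_leftBounds (x : M) : BddBelow (τ.leftBounds x) := ⟨0, fun _ h => h.1⟩

lemma lpNorm_top_mem (x : M) : τ.lpNorm ∞ x ∈ τ.leftBounds x := by
  rw [lpNorm_top]
  refine IsClosed.csInf_mem ?_ ⟨_, τ.norm_mem_leftBounds x⟩ (τ.bddBelow_leftBounds x)
  simp only [leftBounds, Set.ofPred_and, Set.ofPred_forall]
  refine isClosed_Ici.inter (isClosed_iInter fun b => isClosed_le ?_ ?_) <;> fun_prop

lemma lpNorm_top_nonneg (x : M) : 0 ≤ τ.lpNorm ∞ x := (τ.lpNorm_top_mem x).1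

lemma lpNorm_top_le {x : M} {C : ℝ} (h : C ∈ τ.leftBounds x) : τ.lpNorm ∞ x ≤ C := by
  rw [lpNorm_top]
  exact csInf_le (τ.bddBelow_leftBounds x) h

lemma leftBounds_mono {x : M} {C D : ℝ} (h : C ∈ τ.leftBounds x) (hCD : C ≤ D) :
    D ∈ τ.leftBounds x :=
  ⟨h.1.trans hCD, fun b => (h.2 b).trans <| by
    have := τ.re_nonneg b
    have := h.1
    gcongr⟩

lemma continuous_rpow_half (p : ℝ≥0∞) : Continuous fun t : ℝ => t ^ (p.toReal / 2) :=
  Real.continuous_rpow_const (by positivity)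

lemma lpNorm_of_ne_top {p : ℝ≥0∞} (hp : p ≠ ∞) (x : M) : τ.lpNorm p x =
    (τ.toFun (cfc (fun t : ℝ => t ^ (p.toReal / 2)) (star x * x))).re ^ (1 / p.toReal) := by
  simp [lpNorm, hp]

lemma map_cfc_rpow {N : Type*} [CStarAlgebra N] (φ : M →⋆ₐ[ℂ] N) (p : ℝ≥0∞) (x : M) :
    φ (cfc (fun t : ℝ => t ^ (p.toReal / 2)) (star x * x)) =
      cfc (fun t : ℝ => t ^ (p.toReal / 2)) (star (φ x) * φ x) := by
  have h := StarAlgHom.map_cfc φ (fun t : ℝ => t ^ (p.toReal / 2)) (star x * x)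
    (continuous_rpow_half p).continuousOn
    (NonUnitalStarAlgHom.instContinuousLinearMapClassComplex.map_continuous φ)
    (IsSelfAdjoint.star_mul_self x)
    (by rw [map_mul, map_star]; exact IsSelfAdjoint.star_mul_self (φ x))
  simpa [map_star] using h

/-- Left multiplication bounds pass to a trace preserving image with dense range. -/
lemma leftBounds_subset {N : Type*} [CStarAlgebra N] (σ : TraceState N) (φ : M →⋆ₐ[ℂ] N)
    (hφ : ∀ x, σ.toFun (φ x) = τ.toFun x) (hd : DenseRange φ) (x : M) :
    τ.leftBounds x ⊆ σ.leftBounds (φ x) := by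
  refine fun C hC => ⟨hC.1, fun b => ?_⟩
  have hσ := σ.continuous_toFun
  refine hd.induction_on (p := fun b => (σ.toFun (star (φ x * b) * (φ x * b))).re ≤
    C ^ 2 * (σ.toFun (star b * b)).re) b ?_ fun b => ?_
  · exact isClosed_le (by fun_prop) (by fun_prop)
  · simpa [← map_mul, ← map_star, hφ, -star_mul] using hC.2 b

/-- For `p < ∞` functional calculus commutes with `φ`, so equality holds; for `p = ∞` density lets
the bounds be tested on the image of `φ`. Absolute values suffice because the outer `p`-norm takes
them anyway. -/
lemma abs_lpNorm_map_le {N : Type*} [CStarAlgebra N] (σ : TraceState N) (φ : M →⋆ₐ[ℂ] N)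
    (hφ : ∀ x, σ.toFun (φ x) = τ.toFun x) (hd : DenseRange φ) (p : ℝ≥0∞) (x : M) :
    |σ.lpNorm p (φ x)| ≤ |τ.lpNorm p x| := by
  rcases eq_or_ne p ∞ with rfl | hp
  · rw [abs_of_nonneg (σ.lpNorm_top_nonneg _), abs_of_nonneg (τ.lpNorm_top_nonneg _)]
    exact σ.lpNorm_top_le (τ.leftBounds_subset σ φ hφ hd x (τ.lpNorm_top_mem x))
  · rw [lpNorm_of_ne_top _ hp, lpNorm_of_ne_top _ hp, ← map_cfc_rpow, hφ]

/-- No density is needed in this direction: for `p = ∞` the pullback tests the bound only on vectors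
from the image of `φ`. -/
lemma abs_lpNorm_comap_le {N : Type*} [CStarAlgebra N] (φ : N →⋆ₐ[ℂ] M) (p : ℝ≥0∞) (x : N) :
    |(τ.comap φ).lpNorm p x| ≤ |τ.lpNorm p (φ x)| := by
  rcases eq_or_ne p ∞ with rfl | hp
  · rw [abs_of_nonneg (lpNorm_top_nonneg _ _), abs_of_nonneg (τ.lpNorm_top_nonneg _)]
    refine lpNorm_top_le _ ⟨τ.lpNorm_top_nonneg _, fun b => ?_⟩
    simpa [comap_apply, map_star] using (τ.lpNorm_top_mem (φ x)).2 (φ b)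
  · rw [lpNorm_of_ne_top _ hp, lpNorm_of_ne_top _ hp, comap_apply, ← map_cfc_rpow]

end TraceState

/-! ### *-distributions and transport costs of tuples -/

section Tuples

variable {n : ℕ}

lemma map_evalStar {M N : Type*} [CStarAlgebra M] [CStarAlgebra N] (φ : M →⋆ₐ[ℂ] N)
    (X : Fin n → M) (P : FreeAlgebra ℂ (Fin n ⊕ Fin n)) :
    evalStar (fun j => φ (X j)) P = φ (evalStar X P) := by
  have : evalStar (fun j => φ (X j)) = φ.toAlgHom.comp (evalStar X) := by
    ext i
    rcases i with i | i <;> simp [evalStar, map_star]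
  rw [this]
  rfl

lemma starDistribution_apply {M : Type*} [CStarAlgebra M] (τ : TraceState M) (X : Fin n → M)
    (P : FreeAlgebra ℂ (Fin n ⊕ Fin n)) :
    starDistribution τ X P = τ.toFun (evalStar X P) := rfl

/-- Trace preserving *-homomorphisms preserve *-distributions. -/
lemma starDistribution_map {M N : Type*} [CStarAlgebra M] [CStarAlgebra N] (τ : TraceState M)
    (σ : TraceState N) (φ : M →⋆ₐ[ℂ] N) (hφ : ∀ x, σ.toFun (φ x) = τ.toFun x) (X : Fin n → M) :
    starDistribution σ (fun j => φ (X j)) = starDistribution τ X := by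
  ext P
  rw [starDistribution_apply, starDistribution_apply, map_evalStar, hφ]

lemma transportCost_top {M : Type*} [CStarAlgebra M] (τ : TraceState M) (X Y : Fin n → M) :
    transportCost ∞ τ X Y = ⨆ j, |τ.lpNorm ∞ (X j - Y j)| :=
  PiLp.norm_eq_ciSup _

lemma transportCost_of_ne_top {M : Type*} [CStarAlgebra M] {p : ℝ≥0∞} (hp : 1 ≤ p) (hp' : p ≠ ∞)
    (τ : TraceState M) (X Y : Fin n → M) :
    transportCost p τ X Y =
      (∑ j, |τ.lpNorm p (X j - Y j)| ^ p.toReal) ^ (1 / p.toReal) :=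
  PiLp.norm_eq_sum (ENNReal.toReal_pos (zero_lt_one.trans_le hp).ne' hp') _

lemma transportCost_nonneg {M : Type*} [CStarAlgebra M] {p : ℝ≥0∞} (hp : 1 ≤ p)
    (τ : TraceState M) (X Y : Fin n → M) : 0 ≤ transportCost p τ X Y := by
  have : Fact (1 ≤ p) := ⟨hp⟩
  exact norm_nonneg _

lemma transportCost_mono {M N : Type*} [CStarAlgebra M] [CStarAlgebra N] {p : ℝ≥0∞} (hp : 1 ≤ p)
    (τ : TraceState M) (σ : TraceState N) (X Y : Fin n → M) (X' Y' : Fin n → N)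
    (h : ∀ j, |σ.lpNorm p (X' j - Y' j)| ≤ |τ.lpNorm p (X j - Y j)|) :
    transportCost p σ X' Y' ≤ transportCost p τ X Y := by
  rcases eq_or_ne p ∞ with rfl | hp'
  · rw [transportCost_top, transportCost_top]
    exact ciSup_mono (Set.finite_range _).bddAbove h
  · rw [transportCost_of_ne_top hp hp', transportCost_of_ne_top hp hp']
    refine Real.rpow_le_rpow (by positivity) (Finset.sum_le_sum fun j _ => ?_) (by positivity)
    exact Real.rpow_le_rpow (abs_nonneg _) (h j) (by positivity)

end Tuples

/-! ### Tracial vector states -/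

section VectorTrace

open scoped InnerProductSpace

variable {B : Type*} [Ring B] [StarRing B] [Algebra ℂ B]
  {H : Type*} [NormedAddCommGroup H] [InnerProductSpace ℂ H] [CompleteSpace H]

/-- The C*-algebra generated by the range of a *-representation. -/
abbrev repClosure (π : B →⋆ₐ[ℂ] (H →L[ℂ] H)) : StarSubalgebra ℂ (H →L[ℂ] H) :=
  π.range.topologicalClosure

instance (π : B →⋆ₐ[ℂ] (H →L[ℂ] H)) : IsClosed (repClosure π : Set (H →L[ℂ] H)) :=
  StarSubalgebra.isClosed_topologicalClosure _

/-- A *-representation, with values in the C*-algebra it generates. -/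
def toRepClosure (π : B →⋆ₐ[ℂ] (H →L[ℂ] H)) : B →⋆ₐ[ℂ] repClosure π :=
  StarAlgHom.codRestrict π (repClosure π)
    fun x => StarSubalgebra.le_topologicalClosure _ ⟨x, rfl⟩

lemma coe_toRepClosure (π : B →⋆ₐ[ℂ] (H →L[ℂ] H)) (x : B) : (toRepClosure π x : H →L[ℂ] H) = π x :=
  rfl

lemma denseRange_toRepClosure (π : B →⋆ₐ[ℂ] (H →L[ℂ] H)) : DenseRange (toRepClosure π) := by
  rw [DenseRange, Subtype.dense_iff]
  intro x hx
  refine closure_mono ?_ hx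
  rintro _ ⟨y, rfl⟩
  exact ⟨toRepClosure π y, ⟨y, rfl⟩, rfl⟩

/-- The vector state of a unit vector which is tracial on a *-algebra of operators, as a trace
state on the generated C*-algebra. -/
def vectorTrace (π : B →⋆ₐ[ℂ] (H →L[ℂ] H)) (ξ : H) (hξ : ‖ξ‖ = 1)
    (ht : ∀ x y, ⟪ξ, π (x * y) ξ⟫_ℂ = ⟪ξ, π (y * x) ξ⟫_ℂ) : TraceState (repClosure π) where
  toFun :=
    { toFun := fun T => ⟪ξ, (T : H →L[ℂ] H) ξ⟫_ℂ
      map_add' := fun S T => by simp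
      map_smul' := fun c T => by simp }
  map_one' := by simp [inner_self_eq_norm_sq_to_K, hξ]
  nonneg' T := by
    have : ⟪ξ, ((star T * T : repClosure π) : H →L[ℂ] H) ξ⟫_ℂ =
        ⟪(T : H →L[ℂ] H) ξ, (T : H →L[ℂ] H) ξ⟫_ℂ := by
      rw [← ContinuousLinearMap.adjoint_inner_right]
      rfl
    simp only [LinearMap.coe_mk, AddHom.coe_mk, this]
    rw [inner_self_eq_norm_sq_to_K]
    norm_cast
    positivity
  tracial' S T := by
    have hc : Continuous fun T : repClosure π => ⟪ξ, (T : H →L[ℂ] H) ξ⟫_ℂ := by fun_prop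
    refine (denseRange_toRepClosure π).induction_on₂
      (p := fun S T : repClosure π => ⟪ξ, ((S * T : repClosure π) : H →L[ℂ] H) ξ⟫_ℂ =
        ⟪ξ, ((T * S : repClosure π) : H →L[ℂ] H) ξ⟫_ℂ) ?_ (fun x y => ?_) S T
    · exact isClosed_eq (hc.comp (by fun_prop : Continuous fun q : repClosure π × repClosure π =>
        q.1 * q.2)) (hc.comp (by fun_prop : Continuous fun q : repClosure π × repClosure π =>
        q.2 * q.1))
    · rw [← map_mul, ← map_mul, coe_toRepClosure, coe_toRepClosure]
      exact ht x y

lemma vectorTrace_apply (π : B →⋆ₐ[ℂ] (H →L[ℂ] H)) (ξ : H) (hξ : ‖ξ‖ = 1)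
    (ht : ∀ x y, ⟪ξ, π (x * y) ξ⟫_ℂ = ⟪ξ, π (y * x) ξ⟫_ℂ) (x : B) :
    (vectorTrace π ξ hξ ht).toFun (toRepClosure π x) = ⟪ξ, π x ξ⟫_ℂ := rfl

end VectorTrace

/-! ### The GNS representation -/

section GNS

open scoped InnerProductSpace
open UniformSpace

/-- The GNS representation of a trace state. -/
lemma exists_cyclic_rep {M : Type u} [CStarAlgebra M] (τ : TraceState M) :
    ∃ (H : Type u) (_ : NormedAddCommGroup H) (_ : InnerProductSpace ℂ H) (_ : CompleteSpace H)
      (π : M →⋆ₐ[ℂ] (H →L[ℂ] H)) (ξ : H), ‖ξ‖ = 1 ∧ (∀ x, ⟪ξ, π x ξ⟫_ℂ = τ.toFun x) ∧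
      DenseRange fun x => π x ξ := by
  let _ := CStarAlgebra.spectralOrder M
  have := CStarAlgebra.spectralOrderedRing M
  let f := τ.toPositiveLinearMap
  refine ⟨f.GNS, inferInstance, inferInstance, inferInstance, f.gnsStarAlgHom,
    ((f.toPreGNS 1 : f.PreGNS) : f.GNS), ?_, fun x => ?_, ?_⟩
  · rw [Completion.norm_coe, PositiveLinearMap.preGNS_norm_def]
    simp [f, TraceState.toPositiveLinearMap_apply, τ.map_one']
  · change ⟪_, f.gnsNonUnitalStarAlgHom x _⟫_ℂ = _
    rw [PositiveLinearMap.gnsNonUnitalStarAlgHom_apply_coe,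
      Completion.inner_coe, PositiveLinearMap.preGNS_inner_def]
    simp [f, TraceState.toPositiveLinearMap_apply]
  · have : (fun x => f.gnsStarAlgHom x ((f.toPreGNS 1 : f.PreGNS) : f.GNS)) =
        fun x : M => ((f.toPreGNS x : f.PreGNS) : f.GNS) := by
      ext x
      simp
    rw [this]
    exact Completion.denseRange_coe (α := f.PreGNS)

/-- A tracial C*-probability space has a trace preserving homomorphism onto a dense subalgebra of
one in which the operator norm is the norm of `L^∞`. -/
lemma exists_gns {M : Type u} [CStarAlgebra M] (τ : TraceState M) :
    ∃ (N : Type u) (_ : CStarAlgebra N) (σ : TraceState N) (φ : M →⋆ₐ[ℂ] N),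
      (∀ x, σ.toFun (φ x) = τ.toFun x) ∧ DenseRange φ ∧
      ∀ x, ∀ C ∈ τ.leftBounds x, ‖φ x‖ ≤ C := by
  obtain ⟨H, _, _, _, π, ξ, hξ, hτ, hd⟩ := exists_cyclic_rep τ
  refine ⟨repClosure π, inferInstance, vectorTrace π ξ hξ fun x y => ?_, toRepClosure π,
    fun x => ?_, denseRange_toRepClosure π, fun x C hC => ?_⟩
  · rw [hτ, hτ, τ.tracial']
  · rw [vectorTrace_apply, hτ]
  -- This turns a left multiplication bound on `L²` into an operator bound on the dense set of
  -- vectors `π b ξ`.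
  · have hn : ∀ b, ‖π b ξ‖ ^ 2 = (τ.toFun (star b * b)).re := fun b => by
      rw [← hτ, map_mul, map_star, mul_apply_eq_comp,
        ContinuousLinearMap.star_eq_adjoint, ContinuousLinearMap.adjoint_inner_right,
        inner_self_eq_norm_sq_to_K]
      norm_cast
    refine ContinuousLinearMap.opNorm_le_bound _ hC.1 fun η => ?_
    refine hd.induction_on (p := fun η => ‖π x η‖ ≤ C * ‖η‖) η ?_ fun b => ?_
    · exact isClosed_le (by fun_prop) (by fun_prop)
    · rw [← sq_le_sq₀ (norm_nonneg _) (mul_nonneg hC.1 (norm_nonneg _)), mul_pow, hn,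
        ← mul_apply_eq_comp, ← map_mul, hn]
      exact hC.2 b

end GNS

/-! ### Tensor products of tracial spaces -/

section Tensor

open scoped InnerProductSpace TensorProduct
open UniformSpace

/-- A *-representation on a pre-Hilbert space, extended to the completion. -/
def completionRep {B : Type*} [Ring B] [StarRing B] [Algebra ℂ B]
    {V : Type*} [NormedAddCommGroup V] [InnerProductSpace ℂ V] (ρ : B →ₐ[ℂ] (V →L[ℂ] V))
    (h : ∀ b x y, ⟪ρ (star b) x, y⟫_ℂ = ⟪x, ρ b y⟫_ℂ) :
    B →⋆ₐ[ℂ] (Completion V →L[ℂ] Completion V) where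
  toFun b := (ρ b).completion
  map_one' := by
    ext x
    induction x using Completion.induction_on with
    | hp => apply isClosed_eq <;> fun_prop
    | ih x => simp
  map_mul' S T := by
    ext x
    induction x using Completion.induction_on with
    | hp => apply isClosed_eq <;> fun_prop
    | ih x => simp
  map_zero' := by
    ext x
    induction x using Completion.induction_on with
    | hp => apply isClosed_eq <;> fun_prop
    | ih x => simp
  map_add' S T := by
    ext x
    induction x using Completion.induction_on with
    | hp => apply isClosed_eq <;> fun_prop
    | ih x => simp [Completion.coe_add]
  commutes' c := by
    ext x
    induction x using Completion.induction_on with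
    | hp => apply isClosed_eq <;> fun_prop
    | ih x => simp [Algebra.algebraMap_eq_smul_one, Completion.coe_smul]
  map_star' T := by
    refine (ContinuousLinearMap.eq_adjoint_iff _ _).mpr fun x y => ?_
    induction x, y using Completion.induction_on₂ with
    | hp => apply isClosed_eq <;> fun_prop
    | ih x y => simp [h]

lemma completionRep_apply_coe {B : Type*} [Ring B] [StarRing B] [Algebra ℂ B]
    {V : Type*} [NormedAddCommGroup V] [InnerProductSpace ℂ V] (ρ : B →ₐ[ℂ] (V →L[ℂ] V))
    (h : ∀ b x y, ⟪ρ (star b) x, y⟫_ℂ = ⟪x, ρ b y⟫_ℂ) (b : B) (x : V) :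
    completionRep ρ h b x = ρ b x :=
  ContinuousLinearMap.completion_apply_coe _ _

section

variable {E F : Type*} [NormedAddCommGroup E] [InnerProductSpace ℂ E]
  [NormedAddCommGroup F] [InnerProductSpace ℂ F]

variable (E F) in
/-- The homomorphism `T ↦ T ⊗ 1`. -/
def rTensorHom : (E →L[ℂ] E) →ₐ[ℂ] (E ⊗[ℂ] F →L[ℂ] E ⊗[ℂ] F) where
  toFun T := T.rTensor F
  map_one' := ContinuousLinearMap.rTensor_one F
  map_mul' := ContinuousLinearMap.rTensor_mul F
  map_zero' := ContinuousLinearMap.rTensor_zero F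
  map_add' := ContinuousLinearMap.rTensor_add F
  commutes' c := by
    rw [Algebra.algebraMap_eq_smul_one, ContinuousLinearMap.rTensor_smul,
      ContinuousLinearMap.rTensor_one, Algebra.algebraMap_eq_smul_one]

variable (E F) in
/-- The homomorphism `T ↦ 1 ⊗ T`. -/
def lTensorHom : (F →L[ℂ] F) →ₐ[ℂ] (E ⊗[ℂ] F →L[ℂ] E ⊗[ℂ] F) where
  toFun T := T.lTensor E
  map_one' := ContinuousLinearMap.lTensor_one E
  map_mul' := ContinuousLinearMap.lTensor_mul E
  map_zero' := ContinuousLinearMap.lTensor_zero E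
  map_add' := ContinuousLinearMap.lTensor_add E
  commutes' c := by
    rw [Algebra.algebraMap_eq_smul_one, ContinuousLinearMap.lTensor_smul,
      ContinuousLinearMap.lTensor_one, Algebra.algebraMap_eq_smul_one]

lemma commute_rTensorHom_lTensorHom (S : E →L[ℂ] E) (T : F →L[ℂ] F) :
    Commute (rTensorHom E F S) (lTensorHom E F T) := by
  refine ContinuousLinearMap.ext fun z => ?_
  induction z using TensorProduct.induction_on with
  | zero => simp only [map_zero]
  | add z z' h h' => simp only [map_add, h, h']
  | tmul a b => rfl

end

variable {B₁ B₂ : Type*} [Ring B₁] [StarRing B₁] [Algebra ℂ B₁]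
  [Ring B₂] [StarRing B₂] [Algebra ℂ B₂]
  {E F : Type*} [NormedAddCommGroup E] [InnerProductSpace ℂ E] [CompleteSpace E]
  [NormedAddCommGroup F] [InnerProductSpace ℂ F] [CompleteSpace F]

/-- The tensor product of two representations, on the algebraic tensor product. -/
def tensorRep (π₁ : B₁ →⋆ₐ[ℂ] (E →L[ℂ] E)) (π₂ : B₂ →⋆ₐ[ℂ] (F →L[ℂ] F)) :
    B₁ ⊗[ℂ] B₂ →ₐ[ℂ] (E ⊗[ℂ] F →L[ℂ] E ⊗[ℂ] F) :=
  Algebra.TensorProduct.lift ((rTensorHom E F).comp π₁.toAlgHom) ((lTensorHom E F).comp π₂.toAlgHom)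
    fun _ _ => commute_rTensorHom_lTensorHom _ _

lemma tensorRep_tmul_tmul (π₁ : B₁ →⋆ₐ[ℂ] (E →L[ℂ] E)) (π₂ : B₂ →⋆ₐ[ℂ] (F →L[ℂ] F))
    (x : B₁) (y : B₂) (a : E) (b : F) :
    tensorRep π₁ π₂ (x ⊗ₜ y) (a ⊗ₜ b) = π₁ x a ⊗ₜ π₂ y b := by
  exact congrArg (fun T : E ⊗[ℂ] F →L[ℂ] E ⊗[ℂ] F => T (a ⊗ₜ b))
    (Algebra.TensorProduct.lift_tmul _ _ _ x y)

lemma tensorRep_star [StarModule ℂ B₁] [StarModule ℂ B₂]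
    (π₁ : B₁ →⋆ₐ[ℂ] (E →L[ℂ] E)) (π₂ : B₂ →⋆ₐ[ℂ] (F →L[ℂ] F))
    (t : B₁ ⊗[ℂ] B₂) (x y : E ⊗[ℂ] F) :
    ⟪tensorRep π₁ π₂ (star t) x, y⟫_ℂ = ⟪x, tensorRep π₁ π₂ t y⟫_ℂ := by
  induction t using TensorProduct.induction_on with
  | zero => simp
  | add t t' h h' =>
    simp only [star_add, map_add, add_apply, inner_add_left, inner_add_right,
      h, h']
  | tmul s t =>
    induction x using TensorProduct.induction_on with
    | zero => simp
    | add x x' hx hx' => simp only [map_add, inner_add_left, hx, hx']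
    | tmul a b =>
      induction y using TensorProduct.induction_on with
      | zero => simp
      | add y y' hy hy' => simp only [map_add, inner_add_right, hy, hy']
      | tmul c d =>
        rw [TensorProduct.star_tmul, tensorRep_tmul_tmul, tensorRep_tmul_tmul, map_star, map_star,
          TensorProduct.inner_tmul, TensorProduct.inner_tmul, ContinuousLinearMap.star_eq_adjoint,
          ContinuousLinearMap.star_eq_adjoint, ContinuousLinearMap.adjoint_inner_left,
          ContinuousLinearMap.adjoint_inner_left]

/-- The tensor product of two tracial C*-probability spaces. -/
lemma exists_tensor {M₁ : Type u} {M₂ : Type v} [CStarAlgebra M₁] [CStarAlgebra M₂]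
    (τ₁ : TraceState M₁) (τ₂ : TraceState M₂) :
    ∃ (N : Type (max u v)) (_ : CStarAlgebra N) (σ : TraceState N) (φ₁ : M₁ →⋆ₐ[ℂ] N)
      (φ₂ : M₂ →⋆ₐ[ℂ] N), (∀ x, σ.toFun (φ₁ x) = τ₁.toFun x) ∧
      ∀ x, σ.toFun (φ₂ x) = τ₂.toFun x := by
  obtain ⟨E, _, _, _, π₁, ξ₁, hξ₁, hτ₁, -⟩ := exists_cyclic_rep τ₁
  obtain ⟨F, _, _, _, π₂, ξ₂, hξ₂, hτ₂, -⟩ := exists_cyclic_rep τ₂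
  let π := completionRep (tensorRep π₁ π₂) (tensorRep_star π₁ π₂)
  let ξ : Completion (E ⊗[ℂ] F) := ((ξ₁ ⊗ₜ[ℂ] ξ₂ : E ⊗[ℂ] F) : Completion (E ⊗[ℂ] F))
  have hξ : ‖ξ‖ = 1 := by
    rw [Completion.norm_coe, TensorProduct.norm_tmul, hξ₁, hξ₂, one_mul]
  have hπ : ∀ x y, ⟪ξ, π (x ⊗ₜ y) ξ⟫_ℂ = τ₁.toFun x * τ₂.toFun y := fun x y => by
    rw [completionRep_apply_coe, tensorRep_tmul_tmul, Completion.inner_coe,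
      TensorProduct.inner_tmul, hτ₁, hτ₂]
  have ht : ∀ s t, ⟪ξ, π (s * t) ξ⟫_ℂ = ⟪ξ, π (t * s) ξ⟫_ℂ := fun s t => by
    induction s using TensorProduct.induction_on with
    | zero => simp
    | add s s' h h' =>
      simp only [add_mul, mul_add, map_add, add_apply, inner_add_right, h, h']
    | tmul a b =>
      induction t using TensorProduct.induction_on with
      | zero => simp
      | add t t' h h' =>
        simp only [add_mul, mul_add, map_add, add_apply, inner_add_right, h, h']
      | tmul c d =>
        rw [Algebra.TensorProduct.tmul_mul_tmul, Algebra.TensorProduct.tmul_mul_tmul, hπ, hπ,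
          τ₁.tracial', τ₂.tracial']
  let ι₁ : M₁ →⋆ₐ[ℂ] M₁ ⊗[ℂ] M₂ :=
    { (Algebra.TensorProduct.includeLeft : M₁ →ₐ[ℂ] M₁ ⊗[ℂ] M₂) with
      map_star' := fun x => by simp }
  let ι₂ : M₂ →⋆ₐ[ℂ] M₁ ⊗[ℂ] M₂ :=
    { (Algebra.TensorProduct.includeRight : M₂ →ₐ[ℂ] M₁ ⊗[ℂ] M₂) with
      map_star' := fun x => by simp }
  refine ⟨repClosure π, inferInstance, vectorTrace π ξ hξ ht, (toRepClosure π).comp ι₁,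
    (toRepClosure π).comp ι₂, fun x => ?_, fun x => ?_⟩
  · refine (vectorTrace_apply π ξ hξ ht (x ⊗ₜ 1)).trans ?_
    rw [hπ, τ₂.map_one', mul_one]
  · refine (vectorTrace_apply π ξ hξ ht (1 ⊗ₜ x)).trans ?_
    rw [hπ, τ₁.map_one', one_mul]

end Tensor

/-- Otherwise `K * (b / a) ^ 2 ^ (k + 1)` would tend to `0` while staying at least `1`. -/
lemma le_of_pow_two_pow_le {a b K : ℝ} (hb : 0 ≤ b)
    (h : ∀ k : ℕ, a ^ 2 ^ (k + 1) ≤ K * b ^ 2 ^ (k + 1)) : a ≤ b := by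
  by_contra! hba
  have ha : 0 < a := hb.trans_lt hba
  have hlim : Filter.Tendsto (fun k : ℕ => K * (b / a) ^ 2 ^ (k + 1)) Filter.atTop (𝓝 (K * 0)) :=
    ((tendsto_pow_atTop_nhds_zero_of_lt_one (by positivity) ((div_lt_one ha).mpr hba)).comp
      ((tendsto_pow_atTop_atTop_of_one_lt one_lt_two).comp
        (Filter.tendsto_add_atTop_nat 1))).const_mul K
  rw [mul_zero] at hlim
  refine absurd (ge_of_tendsto' hlim fun k => ?_ : (1 : ℝ) ≤ 0) (by norm_num)
  rw [div_pow, mul_div_assoc', one_le_div (by positivity)]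
  exact h k

/-! ### Moments control the `L^∞` norm -/

section Moments

variable {M : Type*} [CStarAlgebra M] (τ : TraceState M)

/-- Iterated Cauchy–Schwarz inequality. -/
lemma TraceState.pow_mul_le {h b : M} (hh : IsSelfAdjoint h)
    (hb : 0 < (τ.toFun (star b * b)).re) (k : ℕ) :
    |(τ.toFun (star b * (h * b))).re| ^ 2 ^ (k + 1) * (τ.toFun (star b * b)).re ≤
      (τ.toFun (star b * b)).re ^ 2 ^ (k + 1) *
        (τ.toFun (star (h ^ 2 ^ k * b) * (h ^ 2 ^ k * b))).re := by
  have cs : ∀ m, |(τ.toFun (star b * (h ^ m * b))).re| ^ 2 ≤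
      (τ.toFun (star b * b)).re * (τ.toFun (star (h ^ m * b) * (h ^ m * b))).re := fun m =>
    (pow_le_pow_left₀ (abs_nonneg _) (Complex.abs_re_le_norm _) 2).trans (τ.norm_sq_le _ _)
  induction k with
  | zero =>
    have := cs 1
    simp only [pow_one] at this
    simp only [zero_add, pow_one, pow_zero]
    nlinarith [mul_le_mul_of_nonneg_right this hb.le]
  | succ k ih =>
    set a₀ := (τ.toFun (star b * b)).re
    set a₁ := |(τ.toFun (star b * (h * b))).re|
    set d := (τ.toFun (star (h ^ 2 ^ k * b) * (h ^ 2 ^ k * b))).re with hd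
    -- As `h` is self-adjoint, `d` is the real part of `τ(b* h^(2^(k+1)) b)`, so Cauchy–Schwarz
    -- applies again with the doubled exponent.
    have h1 : d ^ 2 ≤ a₀ * (τ.toFun (star (h ^ 2 ^ (k + 1) * b) * (h ^ 2 ^ (k + 1) * b))).re := by
      have := cs (2 ^ (k + 1))
      rw [sq_abs] at this
      convert this using 4
      rw [star_mul, (hh.pow _).star_eq, mul_assoc, ← mul_assoc (h ^ _), ← pow_add, ← two_mul,
        ← pow_succ']
    have h2 := pow_le_pow_left₀ (by positivity) ih 2
    rw [mul_pow, mul_pow, ← pow_mul, ← pow_mul, ← pow_succ] at h2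
    have h3 := h2.trans (mul_le_mul_of_nonneg_left h1 (by positivity))
    refine le_of_mul_le_mul_right (a := a₀) ?_ hb
    linarith [h3]

/-- If the elements `x* x` and `y* y` have the same moments, then the norm of `y` bounds the
norm of `x` in `L^∞`. -/
lemma TraceState.norm_mem_leftBounds_of_moments {N : Type*} [CStarAlgebra N] (σ : TraceState N)
    (x : M) (y : N) (h : ∀ m : ℕ, τ.toFun ((star x * x) ^ m) = σ.toFun ((star y * y) ^ m)) :
    ‖y‖ ∈ τ.leftBounds x := by
  refine ⟨norm_nonneg _, fun b => ?_⟩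
  have hx : IsSelfAdjoint (star x * x) := .star_mul_self x
  have he : star (x * b) * (x * b) = star b * (star x * x * b) := by
    rw [star_mul]
    simp only [mul_assoc]
  rw [he]
  refine (le_abs_self _).trans ?_
  -- If `τ(b* b) = 0`, Cauchy–Schwarz makes the left side vanish. Otherwise the iterated inequality
  -- applies, and `K` collects the factors that do not grow with `k`.
  rcases (τ.re_nonneg b).eq_or_lt with hb | hb
  · have := (pow_le_pow_left₀ (abs_nonneg _) (Complex.abs_re_le_norm _) 2).trans
      (τ.norm_sq_le b (star x * x * b))
    rw [← hb, zero_mul] at this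
    rw [← hb, mul_zero]
    nlinarith [abs_nonneg (τ.toFun (star b * (star x * x * b))).re]
  · refine le_of_pow_two_pow_le (K := ‖b‖ ^ 2 / (τ.toFun (star b * b)).re) (by positivity)
      fun k => ?_
    have h1 := τ.pow_mul_le hx hb k
    have h2 : (τ.toFun (star ((star x * x) ^ 2 ^ k * b) * ((star x * x) ^ 2 ^ k * b))).re ≤
        ‖b‖ ^ 2 * (‖y‖ ^ 2) ^ 2 ^ (k + 1) := by
      -- Traciality is essential here: it moves `b` to the inside, where it costs only `‖b‖ ^ 2` and
      -- leaves a pure moment of `x* x`, hence of `y* y`.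
      have e1 : τ.toFun (star ((star x * x) ^ 2 ^ k * b) * ((star x * x) ^ 2 ^ k * b)) =
          τ.toFun (star (star b * (star x * x) ^ 2 ^ k) * (star b * (star x * x) ^ 2 ^ k)) := by
        rw [τ.tracial', star_mul, star_mul, star_star, (hx.pow _).star_eq]
      rw [e1]
      refine (τ.re_conj_le _ _).trans ?_
      rw [norm_star, (hx.pow _).star_eq, ← pow_add, ← two_mul, ← pow_succ', h]
      refine mul_le_mul_of_nonneg_left ?_ (by positivity)
      refine ((Complex.re_le_norm _).trans (σ.norm_apply_le _)).trans ?_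
      refine (norm_pow_le' _ (by positivity)).trans ?_
      rw [CStarRing.norm_star_mul_self, ← sq]
    rw [div_mul_eq_mul_div, le_div_iff₀ hb, mul_pow]
    refine h1.trans ?_
    refine (mul_le_mul_of_nonneg_left h2 (by positivity)).trans (le_of_eq (by ring))

variable {n : ℕ}

/-- The adjoint of a *-polynomial is a *-polynomial. -/
lemma exists_evalStar_star {N : Type*} [CStarAlgebra N] (X : Fin n → M) (Y : Fin n → N)
    (P : FreeAlgebra ℂ (Fin n ⊕ Fin n)) :
    ∃ Q, evalStar X Q = star (evalStar X P) ∧ evalStar Y Q = star (evalStar Y P) := by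
  induction P using FreeAlgebra.induction with
  | grade0 c =>
    exact ⟨algebraMap _ _ (star c), by simp [← algebraMap_star_comm], by
      simp [← algebraMap_star_comm]⟩
  | grade1 i =>
    rcases i with i | i
    · exact ⟨FreeAlgebra.ι ℂ (Sum.inr i), by simp [evalStar], by simp [evalStar]⟩
    · exact ⟨FreeAlgebra.ι ℂ (Sum.inl i), by simp [evalStar], by simp [evalStar]⟩
  | mul P P' h h' =>
    obtain ⟨Q, h1, h2⟩ := h
    obtain ⟨Q', h1', h2'⟩ := h'
    exact ⟨Q' * Q, by simp [h1, h1'], by simp [h2, h2']⟩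
  | add P P' h h' =>
    obtain ⟨Q, h1, h2⟩ := h
    obtain ⟨Q', h1', h2'⟩ := h'
    exact ⟨Q + Q', by simp [h1, h1'], by simp [h2, h2']⟩

/-- The moments of `P(X)* P(X)` are values of the *-distribution of `X`, because `P*` is again a
*-polynomial. -/
lemma norm_evalStar_mem_leftBounds {N : Type*} [CStarAlgebra N] (σ : TraceState N)
    {X : Fin n → M} {Y : Fin n → N} (h : starDistribution τ X = starDistribution σ Y)
    (P : FreeAlgebra ℂ (Fin n ⊕ Fin n)) : ‖evalStar Y P‖ ∈ τ.leftBounds (evalStar X P) := by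
  refine τ.norm_mem_leftBounds_of_moments σ _ _ fun m => ?_
  obtain ⟨Q, hX, hY⟩ := exists_evalStar_star X Y P
  have := DFunLike.congr_fun h ((Q * P) ^ m)
  simpa [starDistribution_apply, hX, hY] using this

end Moments

/-! ### Change of universe -/

section Shrink

/-- Transport of a C*-algebra structure along a bijection. -/
abbrev cstarAlgebraOfEquiv {N : Type u} {M : Type v} [CStarAlgebra M] (e : N ≃ M) :
    CStarAlgebra N :=
  let _ : Ring N := e.ring
  let _ : Algebra ℂ N := e.algebra ℂ
  let r : NormedRing N := NormedRing.induced N M e.ringEquiv e.injective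
  let a : NormedAlgebra ℂ N := NormedAlgebra.induced ℂ N M (e.algEquiv ℂ)
  let s : StarRing N :=
    { star := fun x => e.symm (star (e x))
      star_involutive := fun x => by simp
      star_mul := fun x y => e.injective (by simp [Equiv.mul_def])
      star_add := fun x y => e.injective (by simp [Equiv.add_def]) }
  { r, a, s with
    toCompleteSpace := by
      have hi : Isometry e := Isometry.of_dist_eq fun _ _ => rfl
      exact (completeSpace_congr (e := e) hi.isUniformEmbedding).mpr inferInstance
    norm_mul_self_le := fun x => by
      have := CStarRing.norm_mul_self_le (x := e x)
      refine this.trans (le_of_eq ?_)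
      change _ = ‖e (e.symm (e (e.symm (star (e x))) * e x))‖
      simp
    star_smul := fun c x => e.injective (by
      change e (e.symm (star (e (e.symm (c • e x))))) = e (e.symm (star c • e (e.symm (star (e x)))))
      simp) }

lemma exists_cstarAlgebra_of_small {M : Type v} [CStarAlgebra M] [Small.{u} M] :
    ∃ (N : Type u) (_ : CStarAlgebra N) (φ : N →⋆ₐ[ℂ] M), Function.Bijective φ := by
  let e : Shrink.{u} M ≃ M := (equivShrink M).symm
  let _ := cstarAlgebraOfEquiv e
  refine ⟨Shrink.{u} M, inferInstance,
    { toFun := e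
      map_one' := e.apply_symm_apply _
      map_mul' := fun _ _ => e.apply_symm_apply _
      map_zero' := e.apply_symm_apply _
      map_add' := fun _ _ => e.apply_symm_apply _
      commutes' := fun _ => e.apply_symm_apply _
      map_star' := fun _ => e.apply_symm_apply _ }, e.bijective⟩

variable {n : ℕ}

lemma coe_adjoin_range {M : Type*} [CStarAlgebra M] (X : Fin n → M) :
    (StarAlgebra.adjoin ℂ (Set.range X) : Set M) = Set.range (evalStar X) := by
  have h : (StarAlgebra.adjoin ℂ (Set.range X)).toSubalgebra = (evalStar X).range := by
    rw [StarAlgebra.adjoin_toSubalgebra, evalStar, ← Algebra.adjoin_range_eq_range_freeAlgebra_lift,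
      Set.Sum.elim_range]
    congr 2
    ext x
    simp [eq_star_iff_eq_star, eq_comm]
  exact congrArg (fun S : Subalgebra ℂ M => (S : Set M)) h

/-- Each point of the closure is the limit of a sequence indexed through `F`, so the closure is the
image of a set of sequences `ℕ → F`, which lies in the lowest universe. *-polynomials form such an
`F`. -/
lemma small_closure_range {F : Type} {M : Type v} [MetricSpace M] (f : F → M) :
    Small.{u} (closure (Set.range f)) := by
  let S := {p : ℕ → F // ∃ x : closure (Set.range f), Filter.Tendsto (f ∘ p) Filter.atTop (𝓝 x.1)}
  have : Small.{u} S := small_zero _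
  refine small_of_surjective (α := S) (f := fun p => p.2.choose) fun x => ?_
  obtain ⟨s, hs, hx⟩ := mem_closure_iff_seq_limit.mp x.2
  choose p hp using hs
  have hp' : f ∘ p = s := funext hp
  refine ⟨⟨p, x, hp' ▸ hx⟩, Subtype.ext ?_⟩
  have := Exists.choose_spec (⟨x, hp' ▸ hx⟩ : ∃ x : closure (Set.range f),
    Filter.Tendsto (f ∘ p) Filter.atTop (𝓝 x.1))
  exact tendsto_nhds_unique this (hp' ▸ hx)

/-- Any finite set of elements of a C*-algebra lies in the image of an injective homomorphism from
a C*-algebra in any given universe. -/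
lemma exists_injective_range {M : Type v} [CStarAlgebra M] (X : Fin n → M) :
    ∃ (N : Type u) (_ : CStarAlgebra N) (φ : N →⋆ₐ[ℂ] M), Function.Injective φ ∧
      ∀ j, X j ∈ Set.range φ := by
  let S := (StarAlgebra.adjoin ℂ (Set.range X)).topologicalClosure
  have : IsClosed (S : Set M) := StarSubalgebra.isClosed_topologicalClosure _
  have : Small.{u} S := by
    have h : (S : Set M) = closure (Set.range (evalStar X)) := by
      rw [← coe_adjoin_range]
      rfl
    have h2 : Small.{u} (S : Set M) := by
      rw [h]
      exact small_closure_range _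
    exact h2
  obtain ⟨N, _, φ, hφ⟩ := exists_cstarAlgebra_of_small.{u} (M := S)
  refine ⟨N, inferInstance, S.subtype.comp φ, Subtype.val_injective.comp hφ.injective, fun j => ?_⟩
  obtain ⟨y, hy⟩ := hφ.surjective ⟨X j, StarSubalgebra.le_topologicalClosure _
    (StarAlgebra.subset_adjoin ℂ _ ⟨j, rfl⟩)⟩
  exact ⟨y, congrArg Subtype.val hy⟩

end Shrink

/-! ### Normalized couplings -/

section Normalization

variable {n : ℕ}

/-- A coupling can be replaced, at no greater cost, by one in any universe whose tuples satisfy all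
the norm estimates satisfied by the given ones. -/
lemma exists_normalized_coupling {p : ℝ≥0∞} (hp : 1 ≤ p) {M₁ : Type*} {M₂ : Type*}
    [CStarAlgebra M₁] [CStarAlgebra M₂] {τ₁ : TraceState M₁} {X : Fin n → M₁}
    {τ₂ : TraceState M₂} {Y : Fin n → M₂} {M : Type v} [CStarAlgebra M] (τ : TraceState M)
    (X' Y' : Fin n → M) (hX : starDistribution τ X' = starDistribution τ₁ X)
    (hY : starDistribution τ Y' = starDistribution τ₂ Y) :
    ∃ (N : Type u) (_ : CStarAlgebra N) (σ : TraceState N) (X'' Y'' : Fin n → N),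
      starDistribution σ X'' = starDistribution τ₁ X ∧
      starDistribution σ Y'' = starDistribution τ₂ Y ∧
      transportCost p σ X'' Y'' ≤ transportCost p τ X' Y' ∧
      (∀ P, ‖evalStar X'' P‖ ≤ ‖evalStar X P‖) ∧ ∀ P, ‖evalStar Y'' P‖ ≤ ‖evalStar Y P‖ := by
  obtain ⟨L, _, ρ, φ, hρ, hd, hn⟩ := exists_gns τ
  obtain ⟨N, _, ψ, hψ, hr⟩ :=
    -- Both tuples are moved together, so that the differences `X' j - Y' j` survive.
    exists_injective_range.{u} (Fin.append (fun j => φ (X' j)) fun j => φ (Y' j))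
  have hrX : ∀ j, ∃ x, ψ x = φ (X' j) := fun j => by simpa using hr (Fin.castAdd n j)
  have hrY : ∀ j, ∃ x, ψ x = φ (Y' j) := fun j => by
    simpa only [Fin.append_right, Set.mem_range] using hr (Fin.natAdd n j)
  choose X'' hX'' using hrX
  choose Y'' hY'' using hrY
  have key : ∀ (Z : Fin n → M) (Z'' : Fin n → N), (∀ j, ψ (Z'' j) = φ (Z j)) →
      starDistribution (ρ.comap ψ) Z'' = starDistribution τ Z ∧
      ∀ P, ‖evalStar Z'' P‖ = ‖φ (evalStar Z P)‖ := fun Z Z'' hZ => by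
    refine ⟨?_, fun P => ?_⟩
    · rw [← starDistribution_map (ρ.comap ψ) ρ ψ fun _ => rfl, ← starDistribution_map τ ρ φ hρ]
      simp only [hZ]
    · rw [← NonUnitalStarAlgHom.norm_map ψ hψ, ← map_evalStar, ← map_evalStar]
      simp only [hZ]
  refine ⟨N, inferInstance, ρ.comap ψ, X'', Y'', (key X' X'' hX'').1.trans hX,
    (key Y' Y'' hY'').1.trans hY, transportCost_mono hp _ _ _ _ _ _ fun j => ?_,
    fun P => ((key X' X'' hX'').2 P).trans_le (hn _ _ (norm_evalStar_mem_leftBounds τ τ₁ hX P)),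
    fun P => ((key Y' Y'' hY'').2 P).trans_le (hn _ _ (norm_evalStar_mem_leftBounds τ τ₂ hY P))⟩
  refine (ρ.abs_lpNorm_comap_le ψ p _).trans ?_
  rw [map_sub, hX'', hY'', ← map_sub]
  exact τ.abs_lpNorm_map_le ρ φ hρ hd p _

end Normalization

/-! ### Ultralimits of traces -/

section Ultraproduct

open Filter

variable {M : ℕ → Type w} [∀ k, CStarAlgebra (M k)]

lemma exists_tendsto_trace (τ : ∀ k, TraceState (M k)) (U : Ultrafilter ℕ) (z : lp M ∞) :
    ∃ l : ℂ, Tendsto (fun k => (τ k).toFun (z k)) U (𝓝 l) := by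
  obtain ⟨l, -, hl⟩ := (isCompact_closedBall (0 : ℂ) ‖z‖).ultrafilter_le_nhds
    (U.map fun k => (τ k).toFun (z k)) (by
      rw [le_principal_iff]
      refine Eventually.of_forall (f := (U : Filter ℕ))
        (p := fun k => (τ k).toFun (z k) ∈ Metric.closedBall 0 ‖z‖) fun k => ?_
      simpa using ((τ k).norm_apply_le _).trans (lp.norm_apply_le_norm (by simp) z k))
  exact ⟨l, hl⟩

variable [∀ k, Nontrivial (M k)]

instance : CStarAlgebra (lp M ∞) where

/-- The `k`-th coordinate of the `ℓ^∞`-product. -/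
def coordHom (k : ℕ) : lp M ∞ →⋆ₐ[ℂ] M k where
  toFun z := z k
  map_one' := rfl
  map_mul' _ _ := rfl
  map_zero' := rfl
  map_add' _ _ := rfl
  commutes' _ := rfl
  map_star' _ := rfl

/-- The limit of trace states along an ultrafilter, on the `ℓ^∞`-product. -/
def ultraTrace (τ : ∀ k, TraceState (M k)) (U : Ultrafilter ℕ) : TraceState (lp M ∞) where
  toFun :=
    { toFun := fun z => (exists_tendsto_trace τ U z).choose
      map_add' := fun y z => tendsto_nhds_unique (exists_tendsto_trace τ U (y + z)).choose_spec <| by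
        simpa using (exists_tendsto_trace τ U y).choose_spec.add
          (exists_tendsto_trace τ U z).choose_spec
      map_smul' := fun c z => tendsto_nhds_unique (exists_tendsto_trace τ U (c • z)).choose_spec <| by
        simpa using (exists_tendsto_trace τ U z).choose_spec.const_mul c }
  map_one' := tendsto_nhds_unique (exists_tendsto_trace τ U 1).choose_spec <| by
    simp [(τ _).map_one']
  nonneg' z := ge_of_tendsto' (exists_tendsto_trace τ U (star z * z)).choose_spec fun k =>
    (τ k).nonneg' (z k)
  tracial' y z := tendsto_nhds_unique (exists_tendsto_trace τ U (y * z)).choose_spec <|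
    (exists_tendsto_trace τ U (z * y)).choose_spec.congr fun k => (τ k).tracial' (z k) (y k)

lemma tendsto_ultraTrace (τ : ∀ k, TraceState (M k)) (U : Ultrafilter ℕ) (z : lp M ∞) :
    Tendsto (fun k => (τ k).toFun (coordHom k z)) U (𝓝 ((ultraTrace τ U).toFun z)) :=
  (exists_tendsto_trace τ U z).choose_spec

/-- The power `(z* z)^(p/2)` is a single element of the product whose coordinates are the
corresponding powers, so its traces converge. -/
lemma tendsto_lpNorm_ultraTrace (τ : ∀ k, TraceState (M k)) (U : Ultrafilter ℕ) {p : ℝ≥0∞}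
    (hp : p ≠ ∞) (z : lp M ∞) :
    Tendsto (fun k => (τ k).lpNorm p (coordHom k z)) U (𝓝 ((ultraTrace τ U).lpNorm p z)) := by
  simp only [TraceState.lpNorm_of_ne_top _ hp, ← TraceState.map_cfc_rpow]
  exact (Real.continuous_rpow_const (by positivity)).continuousAt.tendsto.comp
    (Complex.continuous_re.continuousAt.tendsto.comp (tendsto_ultraTrace τ U _))

/-- The `L^∞` norm is defined by inequalities between traces, each of which passes to the limit.
Only this direction is available, since the norm may drop. -/
lemma ultraTrace_lpNorm_top_le (τ : ∀ k, TraceState (M k)) (U : Ultrafilter ℕ) {c : ℝ} (hc : 0 ≤ c)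
    (z : lp M ∞) (h : ∀ᶠ k in U, (τ k).lpNorm ∞ (coordHom k z) ≤ c) :
    (ultraTrace τ U).lpNorm ∞ z ≤ c := by
  refine TraceState.lpNorm_top_le _ ⟨hc, fun b => ?_⟩
  have hre : ∀ y, Tendsto (fun k => ((τ k).toFun (coordHom k y)).re) U
      (𝓝 ((ultraTrace τ U).toFun y).re) := fun y =>
    Complex.continuous_re.continuousAt.tendsto.comp (tendsto_ultraTrace τ U y)
  refine le_of_tendsto_of_tendsto (hre _) ((hre _).const_mul _) (h.mono fun k hk => ?_)
  exact ((τ k).leftBounds_mono ((τ k).lpNorm_top_mem _) hk).2 (coordHom k b)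

variable {n : ℕ}

lemma transportCost_ultraTrace_le {p : ℝ≥0∞} (hp : 1 ≤ p) (τ : ∀ k, TraceState (M k))
    (U : Ultrafilter ℕ) (X Y : Fin n → lp M ∞) {c : ℝ}
    (h : ∀ᶠ k in U, transportCost p (τ k) (fun j => coordHom k (X j))
      (fun j => coordHom k (Y j)) ≤ c) :
    transportCost p (ultraTrace τ U) X Y ≤ c := by
  rcases eq_or_ne p ∞ with rfl | hp'
  -- Nonnegativity of `c` also covers `n = 0`, where the supremum is over the empty family and
  -- equals `0`.
  · have hc : 0 ≤ c := by
      obtain ⟨k, hk⟩ := h.exists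
      exact (transportCost_nonneg hp _ _ _).trans hk
    rw [transportCost_top]
    refine Real.iSup_le (fun j => ?_) hc
    rw [abs_of_nonneg (TraceState.lpNorm_top_nonneg _ _)]
    refine ultraTrace_lpNorm_top_le τ U hc _ (h.mono fun k hk => ?_)
    rw [transportCost_top] at hk
    rw [map_sub]
    exact (le_abs_self _).trans ((le_ciSup (Set.finite_range _).bddAbove j).trans hk)
  · refine le_of_tendsto ?_ h
    simp only [transportCost_of_ne_top hp hp', ← map_sub]
    refine (Real.continuous_rpow_const (by positivity)).continuousAt.tendsto.comp ?_
    refine tendsto_finsetSum _ fun j _ => ?_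
    exact (Real.continuous_rpow_const (by positivity)).continuousAt.tendsto.comp
      (tendsto_lpNorm_ultraTrace τ U hp' _).abs

/-- A bounded sequence of tuples, as a tuple in the `ℓ^∞`-product. -/
def boundedTuple (X : ∀ k, Fin n → M k) (R : ℝ) (hX : ∀ k j, ‖X k j‖ ≤ R) (j : Fin n) : lp M ∞ :=
  ⟨fun k => X k j, memℓp_infty ⟨R, by rintro _ ⟨k, rfl⟩; exact hX k j⟩⟩

lemma coordHom_boundedTuple (X : ∀ k, Fin n → M k) (R : ℝ) (hX : ∀ k j, ‖X k j‖ ≤ R) (k : ℕ)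
    (j : Fin n) : coordHom k (boundedTuple X R hX j) = X k j := rfl

lemma tendsto_starDistribution_ultraTrace (τ : ∀ k, TraceState (M k)) (U : Ultrafilter ℕ)
    (X : Fin n → lp M ∞) (P : FreeAlgebra ℂ (Fin n ⊕ Fin n)) :
    Tendsto (fun k => starDistribution (τ k) (fun j => coordHom k (X j)) P) U
      (𝓝 (starDistribution (ultraTrace τ U) X P)) := by
  simp only [starDistribution_apply, map_evalStar]
  exact tendsto_ultraTrace τ U _

end Ultraproduct

/-! ### Limit couplings, attainment and semicontinuity -/

section Compactness

open Filter

variable {n : ℕ}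

/-- Couplings of bounded tuples which converge in *-distribution have a limit coupling. -/
lemma exists_limit_coupling {p : ℝ≥0∞} (hp : 1 ≤ p) {M₁ : Type*} {M₂ : Type*}
    [CStarAlgebra M₁] [CStarAlgebra M₂] {M₁k : ℕ → Type u} {M₂k : ℕ → Type v}
    [∀ k, CStarAlgebra (M₁k k)] [∀ k, CStarAlgebra (M₂k k)]
    (τ₁ : TraceState M₁) (τ₂ : TraceState M₂)
    (τ₁k : ∀ k, TraceState (M₁k k)) (τ₂k : ∀ k, TraceState (M₂k k))
    (X : Fin n → M₁) (Y : Fin n → M₂) (Xk : ∀ k, Fin n → M₁k k) (Yk : ∀ k, Fin n → M₂k k) (R : ℝ)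
    (hXR : ∀ k j, ‖Xk k j‖ ≤ R) (hYR : ∀ k j, ‖Yk k j‖ ≤ R) (U : Ultrafilter ℕ)
    (hX : ∀ P, Tendsto (fun k => starDistribution (τ₁k k) (Xk k) P) U
      (𝓝 (starDistribution τ₁ X P)))
    (hY : ∀ P, Tendsto (fun k => starDistribution (τ₂k k) (Yk k) P) U
      (𝓝 (starDistribution τ₂ Y P)))
    (c : ℕ → ℝ) (hc : ∀ k, c k ∈ couplingCosts.{u, v, w} p (τ₁k k) (Xk k) (τ₂k k) (Yk k)) :
    ∃ c₀ ∈ couplingCosts.{_, _, w} p τ₁ X τ₂ Y, ∀ b, (∀ᶠ k in U, c k ≤ b) → c₀ ≤ b := by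
  choose M' _ τ' X' Y' hX' hY' hc' using hc
  -- Normalization makes the coupled tuples bounded by `R`, so that they define elements of the
  -- ℓ^∞-product.
  have hN := fun k => exists_normalized_coupling.{w} hp (τ' k) (X' k) (Y' k) (hX' k) (hY' k)
  choose N _ σ X'' Y'' hX'' hY'' hcost hbX hbY using hN
  have : ∀ k, Nontrivial (N k) := fun k => (σ k).nontrivial
  have hR : ∀ k j, ‖X'' k j‖ ≤ R := fun k j => by
    simpa [evalStar] using (hbX k (FreeAlgebra.ι ℂ (Sum.inl j))).trans
      (by simpa [evalStar] using hXR k j)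
  have hR' : ∀ k j, ‖Y'' k j‖ ≤ R := fun k j => by
    simpa [evalStar] using (hbY k (FreeAlgebra.ι ℂ (Sum.inl j))).trans
      (by simpa [evalStar] using hYR k j)
  refine ⟨_, ⟨lp N ∞, inferInstance, ultraTrace σ U, boundedTuple X'' R hR, boundedTuple Y'' R hR',
    ?_, ?_, rfl⟩, fun b hb => ?_⟩
  · refine LinearMap.ext fun P => tendsto_nhds_unique (tendsto_starDistribution_ultraTrace σ U _ P) ?_
    simp only [coordHom_boundedTuple]
    exact (hX P).congr fun k => (DFunLike.congr_fun (hX'' k) P).symm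
  · refine LinearMap.ext fun P => tendsto_nhds_unique (tendsto_starDistribution_ultraTrace σ U _ P) ?_
    simp only [coordHom_boundedTuple]
    exact (hY P).congr fun k => (DFunLike.congr_fun (hY'' k) P).symm
  · refine transportCost_ultraTrace_le hp σ U _ _ (hb.mono fun k hk => ?_)
    simp only [coordHom_boundedTuple]
    exact (hcost k).trans ((hc' k).symm.le.trans hk)

/-- The independent coupling in the tensor product serves; normalization only moves it to the
required universe. -/
lemma couplingCosts_nonempty (p : ℝ≥0∞) (hp : 1 ≤ p) {M₁ : Type u} {M₂ : Type v}
    [CStarAlgebra M₁] [CStarAlgebra M₂] (τ₁ : TraceState M₁) (X : Fin n → M₁)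
    (τ₂ : TraceState M₂) (Y : Fin n → M₂) : (couplingCosts.{u, v, w} p τ₁ X τ₂ Y).Nonempty := by
  obtain ⟨N, _, σ, φ₁, φ₂, h₁, h₂⟩ := exists_tensor τ₁ τ₂
  obtain ⟨N', _, σ', X', Y', hX, hY, -⟩ := exists_normalized_coupling.{w} hp σ
    (fun j => φ₁ (X j)) (fun j => φ₂ (Y j)) (starDistribution_map τ₁ σ φ₁ h₁ X)
    (starDistribution_map τ₂ σ φ₂ h₂ Y)
  exact ⟨_, N', inferInstance, σ', X', Y', hX, hY, rfl⟩

lemma bddBelow_couplingCosts {p : ℝ≥0∞} (hp : 1 ≤ p) {M₁ : Type u} {M₂ : Type v}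
    [CStarAlgebra M₁] [CStarAlgebra M₂] (τ₁ : TraceState M₁) (X : Fin n → M₁)
    (τ₂ : TraceState M₂) (Y : Fin n → M₂) : BddBelow (couplingCosts.{u, v, w} p τ₁ X τ₂ Y) := by
  refine ⟨0, ?_⟩
  rintro _ ⟨N, _, σ, X', Y', -, -, rfl⟩
  exact transportCost_nonneg hp _ _ _

/-- Optimal couplings exist. -/
lemma isLeast_wasserstein {p : ℝ≥0∞} (hp : 1 ≤ p) {M₁ : Type u} {M₂ : Type v}
    [CStarAlgebra M₁] [CStarAlgebra M₂] (τ₁ : TraceState M₁) (X : Fin n → M₁)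
    (τ₂ : TraceState M₂) (Y : Fin n → M₂) :
    IsLeast (couplingCosts.{u, v, w} p τ₁ X τ₂ Y) (wasserstein.{u, v, w} p τ₁ X τ₂ Y) := by
  have hb := bddBelow_couplingCosts.{u, v, w} hp τ₁ X τ₂ Y
  obtain ⟨c, -, hlim, hc⟩ := exists_seq_tendsto_sInf (couplingCosts_nonempty p hp τ₁ X τ₂ Y) hb
  -- The tuples are constant in `k`; only the couplings, a minimizing sequence, vary.
  obtain ⟨c₀, hc₀, hle⟩ := exists_limit_coupling hp τ₁ τ₂ (fun _ => τ₁) (fun _ => τ₂) X Y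
    (fun _ => X) (fun _ => Y) (max ‖X‖ ‖Y‖) (fun _ j => (norm_le_pi_norm X j).trans (le_max_left _ _))
    (fun _ j => (norm_le_pi_norm Y j).trans (le_max_right _ _)) (hyperfilter ℕ)
    (fun _ => tendsto_const_nhds) (fun _ => tendsto_const_nhds) c hc
  have heq : c₀ = wasserstein p τ₁ X τ₂ Y := by
    refine le_antisymm (le_of_forall_gt_imp_ge_of_dense fun b hb' => hle b ?_) (csInf_le hb hc₀)
    exact Nat.hyperfilter_le_atTop ((hlim.eventually_lt_const hb').mono fun _ h => h.le)
  exact ⟨heq ▸ hc₀, fun _ h => csInf_le hb h⟩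

/-- Lower semicontinuity of the Wasserstein distance on bounded tuples. -/
lemma wasserstein_le_liminf {p : ℝ≥0∞} (hp : 1 ≤ p) {M₁ : Type u} {M₂ : Type v}
    [CStarAlgebra M₁] [CStarAlgebra M₂] {M₁k : ℕ → Type u} {M₂k : ℕ → Type v}
    [∀ k, CStarAlgebra (M₁k k)] [∀ k, CStarAlgebra (M₂k k)]
    (τ₁ : TraceState M₁) (τ₂ : TraceState M₂)
    (τ₁k : ∀ k, TraceState (M₁k k)) (τ₂k : ∀ k, TraceState (M₂k k))
    (X : Fin n → M₁) (Y : Fin n → M₂) (Xk : ∀ k, Fin n → M₁k k) (Yk : ∀ k, Fin n → M₂k k) (R : ℝ)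
    (hXR : ∀ k j, ‖Xk k j‖ ≤ R) (hYR : ∀ k j, ‖Yk k j‖ ≤ R)
    (hX : ∀ P, Tendsto (fun k => starDistribution (τ₁k k) (Xk k) P) atTop
      (𝓝 (starDistribution τ₁ X P)))
    (hY : ∀ P, Tendsto (fun k => starDistribution (τ₂k k) (Yk k) P) atTop
      (𝓝 (starDistribution τ₂ Y P))) :
    ((wasserstein.{u, v, w} p τ₁ X τ₂ Y : ℝ) : EReal) ≤
      liminf (fun k => ((wasserstein.{u, v, w} p (τ₁k k) (Xk k) (τ₂k k) (Yk k) : ℝ) : EReal))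
        atTop := by
  refine le_of_forall_gt_imp_ge_of_dense fun b hb => ?_
  by_contra! hlt
  obtain ⟨r, hbr, hr⟩ := EReal.exists_between_coe_real hlt
  have hf : ∃ᶠ k in atTop,
      ((wasserstein.{u, v, w} p (τ₁k k) (Xk k) (τ₂k k) (Yk k) : ℝ) : EReal) < r :=
    frequently_lt_of_liminf_lt (by isBoundedDefault) (hb.trans hbr)
  -- `U` plays the role of a subsequence along which the distances stay below `r`.
  obtain ⟨U, hU⟩ := @Ultrafilter.exists_le _ _ (frequently_iff_neBot.mp hf)
  rw [le_inf_iff, le_principal_iff] at hU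
  obtain ⟨c₀, hc₀, hle⟩ := exists_limit_coupling hp τ₁ τ₂ τ₁k τ₂k X Y Xk Yk R hXR hYR U
    (fun P => (hX P).mono_left hU.1) (fun P => (hY P).mono_left hU.1)
    (fun k => wasserstein.{u, v, w} p (τ₁k k) (Xk k) (τ₂k k) (Yk k))
    fun k => (isLeast_wasserstein hp _ _ _ _).1
  have h1 := hle r (Eventually.mono hU.2 fun k hk => (EReal.coe_lt_coe_iff.mp hk).le)
  have h2 := (isLeast_wasserstein.{u, v, w} hp τ₁ X τ₂ Y).2 hc₀
  exact absurd (EReal.coe_le_coe_iff.mpr (h2.trans h1)) (not_le.mpr hr)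

end Compactness

/-! ### Homomorphisms and traces determined on generators -/

section Extension

variable {n : ℕ}

lemma Generates.denseRange {A : Type u} [CStarAlgebra A] {a : Fin n → A} (ha : Generates a) :
    DenseRange (evalStar a) := by
  rw [DenseRange, ← coe_adjoin_range, dense_iff_closure_eq, ← StarSubalgebra.topologicalClosure_coe,
    ha]
  rfl

/-- A C*-algebra with a specified generator maps onto the C*-algebra generated by any tuple
whose *-polynomials have no larger norms. -/
lemma Generates.exists_starAlgHom {A : Type u} [CStarAlgebra A] {a : Fin n → A}
    (ha : Generates a) {N : Type v} [CStarAlgebra N] (X : Fin n → N)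
    (h : ∀ P, ‖evalStar X P‖ ≤ ‖evalStar a P‖) :
    ∃ π : A →⋆ₐ[ℂ] N, ∀ j, π (a j) = X j := by
  -- The homomorphism is built from its graph `D`, generated by the pairs `(a j, X j)`. The norm
  -- bound makes the first projection injective on `D`, hence isometric with closed range; the range
  -- is also dense, so the projection can be inverted.
  let Z : Fin n → A × N := fun j => (a j, X j)
  let D := (StarAlgebra.adjoin ℂ (Set.range Z)).topologicalClosure
  have : IsClosed (D : Set (A × N)) := StarSubalgebra.isClosed_topologicalClosure _
  have hD : (D : Set (A × N)) = closure (Set.range (evalStar Z)) := by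
    rw [← coe_adjoin_range]
    rfl
  have h1 : ∀ P, (evalStar Z P).1 = evalStar a P := fun P =>
    (map_evalStar (StarAlgHom.fst ℂ A N) Z P).symm
  have h2 : ∀ P, (evalStar Z P).2 = evalStar X P := fun P =>
    (map_evalStar (StarAlgHom.snd ℂ A N) Z P).symm
  have hle : ∀ z ∈ D, ‖z.2‖ ≤ ‖z.1‖ := fun z hz => by
    have hz' : z ∈ closure (Set.range (evalStar Z)) := hD ▸ hz
    refine closure_minimal (t := {z : A × N | ‖z.2‖ ≤ ‖z.1‖}) ?_ ?_ hz'
    · rintro _ ⟨P, rfl⟩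
      change ‖(evalStar Z P).2‖ ≤ ‖(evalStar Z P).1‖
      rw [h1, h2]
      exact h P
    · exact isClosed_le (by fun_prop) (by fun_prop)
  let f : D →⋆ₐ[ℂ] A := (StarAlgHom.fst ℂ A N).comp D.subtype
  have hf : ∀ z : D, f z = z.1.1 := fun _ => rfl
  have hinj : Function.Injective f := by
    refine (injective_iff_map_eq_zero f).mpr fun z hz => Subtype.ext (Prod.ext hz ?_)
    have := hle z z.2
    rw [← hf, hz, norm_zero] at this
    exact norm_le_zero_iff.mp this
  have hiso : Isometry f := AddMonoidHomClass.isometry_of_norm f fun z =>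
    NonUnitalStarAlgHom.norm_map f hinj z
  have hmem : ∀ P, evalStar Z P ∈ D := fun P => by
    rw [← SetLike.mem_coe, hD]
    exact subset_closure ⟨P, rfl⟩
  have hsurj : Function.Surjective f := by
    rw [← Set.range_eq_univ, ← hiso.isClosedEmbedding.isClosed_range.closure_eq]
    refine dense_iff_closure_eq.mp (ha.denseRange.mono ?_)
    rintro _ ⟨P, rfl⟩
    exact ⟨⟨evalStar Z P, hmem P⟩, h1 P⟩
  let e := StarAlgEquiv.ofBijective f ⟨hinj, hsurj⟩
  refine ⟨((StarAlgHom.snd ℂ A N).comp D.subtype).comp (e.symm : A →⋆ₐ[ℂ] D), fun j => ?_⟩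
  have hj : Z j ∈ D := by simpa [evalStar] using hmem (FreeAlgebra.ι ℂ (Sum.inl j))
  have he : e.symm (a j) = ⟨Z j, hj⟩ := e.symm_apply_eq.mpr rfl
  change ((e.symm (a j) : D) : A × N).2 = X j
  rw [he]

lemma Generates.trace_eq {A : Type u} [CStarAlgebra A] {a : Fin n → A} (ha : Generates a)
    {N : Type v} [CStarAlgebra N] (τ : TraceState A) (σ : TraceState N) (π : A →⋆ₐ[ℂ] N)
    (h : starDistribution σ (fun j => π (a j)) = starDistribution τ a) (x : A) :
    σ.toFun (π x) = τ.toFun x := by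
  refine congrFun (ha.denseRange.equalizer (g := (σ.comap π).toFun) (h := τ.toFun)
    (TraceState.continuous_toFun _) τ.continuous_toFun (funext fun P => ?_)) x
  change σ.toFun (π (evalStar a P)) = _
  rw [← map_evalStar]
  exact DFunLike.congr_fun h P

end Extension

/-! ### Couplings and traces on the free product -/

section FreeProduct

variable {A₁ A₂ : Type u} [CStarAlgebra A₁] [CStarAlgebra A₂]

/-- The homomorphism from the full free product induced by a pair of homomorphisms. -/
def RepPair.hom (i : RepPair A₁ A₂) : FreeProduct A₁ A₂ →⋆ₐ[ℂ] i.carrier where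
  toFun z := z.1 i
  map_one' := rfl
  map_mul' _ _ := rfl
  map_zero' := rfl
  map_add' _ _ := rfl
  commutes' _ := rfl
  map_star' _ := rfl

lemma RepPair.hom_incl₁ (i : RepPair A₁ A₂) (x : A₁) : i.hom (incl₁ A₁ A₂ x) = i.fst x := rfl

lemma RepPair.hom_incl₂ (i : RepPair A₁ A₂) (x : A₂) : i.hom (incl₂ A₁ A₂ x) = i.snd x := rfl

variable {n : ℕ} {A : Type u} [CStarAlgebra A]

/-- A normalized coupling in the universe of `A` gives two homomorphisms of `A` into one algebra,
that is, an index of the product defining the free product. The trace is pulled back along that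
coordinate. -/
lemma exists_freeProductCost_le {p : ℝ≥0∞} (hp : 1 ≤ p) {a : Fin n → A} (ha : Generates a)
    (τ' τ'' : TraceState A) {c : ℝ} (hc : c ∈ couplingCosts.{u, u, w} p τ' a τ'' a) :
    ∃ c' ∈ freeProductCosts p a τ' τ'', c' ≤ c := by
  obtain ⟨M, _, τ, X, Y, hX, hY, rfl⟩ := hc
  obtain ⟨N, _, σ, X', Y', hX', hY', hcost, hnX, hnY⟩ :=
    exists_normalized_coupling.{u} hp τ X Y hX hY
  have := σ.nontrivial
  obtain ⟨π₁, hπ₁⟩ := ha.exists_starAlgHom X' hnX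
  obtain ⟨π₂, hπ₂⟩ := ha.exists_starAlgHom Y' hnY
  let i : RepPair A A := ⟨N, π₁, π₂⟩
  refine ⟨_, ⟨σ.comap i.hom, ⟨fun x => ?_, fun x => ?_⟩, rfl⟩, (transportCost_mono hp σ _ X' Y' _ _
    fun j => ?_).trans hcost⟩
  · exact ha.trace_eq τ' σ π₁ (by simpa only [hπ₁] using hX') x
  · exact ha.trace_eq τ'' σ π₂ (by simpa only [hπ₂] using hY') x
  · refine (σ.abs_lpNorm_comap_le i.hom p _).trans (le_of_eq ?_)
    rw [map_sub, i.hom_incl₁, i.hom_incl₂]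
    change |σ.lpNorm p (π₁ (a j) - π₂ (a j))| = _
    rw [hπ₁, hπ₂]

/-- A joint trace is already a coupling, except that the free product lives one universe higher than
`A`; normalization repairs this. -/
lemma exists_couplingCost_le_of_freeProduct {p : ℝ≥0∞} (hp : 1 ≤ p) {a : Fin n → A}
    {τ' τ'' : TraceState A} {c : ℝ} (hc : c ∈ freeProductCosts p a τ' τ'') :
    ∃ c' ∈ couplingCosts.{u, u, w} p τ' a τ'' a, c' ≤ c := by
  obtain ⟨τ, ⟨h₁, h₂⟩, rfl⟩ := hc
  obtain ⟨N, _, σ, X', Y', hX', hY', hcost, -⟩ := exists_normalized_coupling.{w} hp τ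
    (fun j => incl₁ A A (a j)) (fun j => incl₂ A A (a j))
    (starDistribution_map τ' τ (incl₁ A A) h₁ a) (starDistribution_map τ'' τ (incl₂ A A) h₂ a)
  exact ⟨_, ⟨N, inferInstance, σ, X', Y', hX', hY', rfl⟩, hcost⟩

/-- The Wasserstein distance of trace states is attained on the free product. -/
lemma isLeast_freeProductCosts {p : ℝ≥0∞} (hp : 1 ≤ p) {a : Fin n → A} (ha : Generates a)
    (τ' τ'' : TraceState A) :
    IsLeast (freeProductCosts p a τ' τ'') (traceWasserstein.{u, w} p a τ' τ'') := by
  have hW := isLeast_wasserstein.{u, u, w} hp τ' a τ'' a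
  have hle : ∀ c ∈ freeProductCosts p a τ' τ'', traceWasserstein.{u, w} p a τ' τ'' ≤ c :=
    fun c hc => by
      obtain ⟨c', hc', h⟩ := exists_couplingCost_le_of_freeProduct.{u, w} hp hc
      exact (hW.2 hc').trans h
  obtain ⟨c, hc, hcW⟩ := exists_freeProductCost_le hp ha τ' τ'' hW.1
  exact ⟨le_antisymm (hle c hc) hcW ▸ hc, hle⟩

end FreeProduct

end FreeWasserstein

end

theorem proposition1p4 (p : ℝ≥0∞) (hp : 1 ≤ p) (n : ℕ) :
    -- (a) the infimum is attained, for `n`-tuples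
    (∀ (M₁ : Type u) (M₂ : Type v) [CStarAlgebra M₁] [CStarAlgebra M₂]
      (τ₁ : FreeWasserstein.TraceState M₁) (τ₂ : FreeWasserstein.TraceState M₂)
      (X : Fin n → M₁) (Y : Fin n → M₂),
      IsLeast (FreeWasserstein.couplingCosts.{u, v, w} p τ₁ X τ₂ Y)
        (FreeWasserstein.wasserstein.{u, v, w} p τ₁ X τ₂ Y)) ∧
    -- (a) the infimum is attained, for trace states, both over couplings of the generators
    -- and over the trace states of the full free product
    (∀ (A : Type u) [CStarAlgebra A] (a : Fin n → A), FreeWasserstein.Generates a →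
      ∀ τ' τ'' : FreeWasserstein.TraceState A,
      IsLeast (FreeWasserstein.couplingCosts.{u, u, w} p τ' a τ'' a)
        (FreeWasserstein.traceWasserstein.{u, w} p a τ' τ'') ∧
      IsLeast (FreeWasserstein.freeProductCosts p a τ' τ'')
        (FreeWasserstein.traceWasserstein.{u, w} p a τ' τ'')) ∧
    -- (b) lower semicontinuity under weak* convergence of trace states
    (∀ (A : Type u) [CStarAlgebra A] (a : Fin n → A), FreeWasserstein.Generates a →
      ∀ (τ₁ τ₂ : FreeWasserstein.TraceState A) (τ₁k τ₂k : ℕ → FreeWasserstein.TraceState A),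
      (∀ x : A, Filter.Tendsto (fun k => (τ₁k k).toFun x) Filter.atTop (𝓝 (τ₁.toFun x))) →
      (∀ x : A, Filter.Tendsto (fun k => (τ₂k k).toFun x) Filter.atTop (𝓝 (τ₂.toFun x))) →
      ((FreeWasserstein.traceWasserstein.{u, w} p a τ₁ τ₂ : ℝ) : EReal) ≤
        Filter.liminf
          (fun k => ((FreeWasserstein.traceWasserstein.{u, w} p a (τ₁k k) (τ₂k k) : ℝ) : EReal))
          Filter.atTop) ∧
    -- (c) lower semicontinuity under convergence in *-distribution of bounded `n`-tuples
    (∀ (M₁ : Type u) (M₂ : Type v) [CStarAlgebra M₁] [CStarAlgebra M₂]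
      (M₁k : ℕ → Type u) (M₂k : ℕ → Type v)
      [∀ k, CStarAlgebra (M₁k k)] [∀ k, CStarAlgebra (M₂k k)]
      (τ₁ : FreeWasserstein.TraceState M₁) (τ₂ : FreeWasserstein.TraceState M₂)
      (τ₁k : ∀ k, FreeWasserstein.TraceState (M₁k k))
      (τ₂k : ∀ k, FreeWasserstein.TraceState (M₂k k))
      (X : Fin n → M₁) (Y : Fin n → M₂) (Xk : ∀ k, Fin n → M₁k k) (Yk : ∀ k, Fin n → M₂k k)
      (R : ℝ),
      (∀ j, ‖X j‖ ≤ R) → (∀ j, ‖Y j‖ ≤ R) →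
      (∀ k j, ‖Xk k j‖ ≤ R) → (∀ k j, ‖Yk k j‖ ≤ R) →
      (∀ P, Filter.Tendsto (fun k => FreeWasserstein.starDistribution (τ₁k k) (Xk k) P)
        Filter.atTop (𝓝 (FreeWasserstein.starDistribution τ₁ X P))) →
      (∀ P, Filter.Tendsto (fun k => FreeWasserstein.starDistribution (τ₂k k) (Yk k) P)
        Filter.atTop (𝓝 (FreeWasserstein.starDistribution τ₂ Y P))) →
      ((FreeWasserstein.wasserstein.{u, v, w} p τ₁ X τ₂ Y : ℝ) : EReal) ≤
        Filter.liminf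
          (fun k => ((FreeWasserstein.wasserstein.{u, v, w} p (τ₁k k) (Xk k) (τ₂k k) (Yk k) : ℝ) :
            EReal))
          Filter.atTop) := by
  refine ⟨fun M₁ M₂ _ _ τ₁ τ₂ X Y => FreeWasserstein.isLeast_wasserstein hp τ₁ X τ₂ Y,
    fun A _ a ha τ' τ'' => ⟨FreeWasserstein.isLeast_wasserstein hp τ' a τ'' a,
      FreeWasserstein.isLeast_freeProductCosts hp ha τ' τ''⟩,
    fun A _ a _ τ₁ τ₂ τ₁k τ₂k h₁ h₂ => ?_, ?_⟩
  -- Weak* convergence, evaluated at the elements `evalStar a P`, is convergence in *-distribution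
  -- of the fixed tuple `a`.
  · exact FreeWasserstein.wasserstein_le_liminf hp τ₁ τ₂ τ₁k τ₂k a a (fun _ => a) (fun _ => a) ‖a‖
      (fun _ => norm_le_pi_norm a) (fun _ => norm_le_pi_norm a) (fun _ => h₁ _) fun _ => h₂ _
  · intro M₁ M₂ _ _ M₁k M₂k _ _ τ₁ τ₂ τ₁k τ₂k X Y Xk Yk R _ _ hXk hYk hX hY
    exact FreeWasserstein.wasserstein_le_liminf hp τ₁ τ₂ τ₁k τ₂k X Y Xk Yk R hXk hYk hX hY
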